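/- Let $K$ be a field and let $\mathcal G=\langle \mathbf g_1,\dots,\mathbf g_n\rangle$ and $\mathcal F=\langle \mathbf f_1,\dots,\mathbf f_n\rangle$ be abelian groups with distinguished generators, each grading $K[x_1,\dots,x_n]$ by giving $x_i$ the degree $\mathbf g_i$, respectively $\mathbf f_i$. For vectors $\mathbf h_1,\dots,\mathbf h_n$ in an abelian group $\mathcal H$ let $L_{\mathcal H}=\{u\in\mathbb Z^n:\sum_i u_i\mathbf h_i=0\}$ be their lattice of relations. Assume that the $\mathcal G$-grading is positive, i.e. $L_{\mathcal G}\cap\mathbb N^n=\{0\}$, and that $\mathcal F\le\mathcal G$, i.e. every $\mathcal G$-homogeneous ideal of $K[x_1,\dots,x_n]$ (one generated by $\mathcal G$-homogeneous polynomials) is $\mathcal F$-homogeneous. Let $I_{L_{\mathcal G}}=(x^{\alpha_+}-x^{\alpha_-}:\alpha\in L_{\mathcal G})$ be the lattice ideal. For a lattice $L\subset\mathbb Z^n$ let $\mathrm{Sat}(L)=\{\alpha\in\mathbb Z^n: d\alpha\in L\text{ for some } d\in\mathbb Z\setminus\{0\}\}$. Choose vectors $\mathbf a_1,\dots,\mathbf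 a_n\in\mathbb Z^m$ and $\mathbf b_1,\dots,\mathbf b_n\in\mathbb Z^q$ whose lattices of relations are $\mathrm{Sat}(L_{\mathcal G})$ and $\mathrm{Sat}(L_{\mathcal F})$, respectively. Let $\sigma=\mathrm{pos}_{\mathbb Q}(\mathbf a_1,\dots,\mathbf a_n)$, let $\mathbf r_1,\dots,\mathbf r_t$ be integer vectors, one on each extreme ray of $\sigma$, and let $\pi$ be the linear projection of $\sigma$ onto $\mathrm{pos}_{\mathbb Q}(\mathbf b_1,\dots,\mathbf b_n)$ with $\pi(\mathbf a_i)=\mathbf b_i$. For $E\subset\{1,\dots,t\}$ put $\sigma(E)=\mathrm{pos}_{\mathbb Q}(\mathbf r_j: j\in E)$, and let $\mathbb E_1,\dots,\mathbb E_l$ be the sets $E$ for which $\sigma(E)$ is minimal, under inclusion, among those cones $\sigma(E)$ that are not faces of $\sigma$. Let $\mathcal D_{\mathcal F}^{\mathcal G}$ be the simplicial complex with vertices $\mathbb E_1,\dots,\mathbb E_l$ in which a nonempty set $T$ of vertices is a simplex if and only if $\bigcap_{\mathbb E_i\in T}\mathrm{relint}_{\mathbb Q}(\pi(\sigma(\mathbb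 E_i)))\ne\emptyset$; $\mathcal D_{\mathcal G}^{\mathcal G}$ is the case $\mathcal F=\mathcal G$, $\pi=\mathrm{id}$. For a finite simplicial complex $\mathcal D$, a matching is a set of pairwise disjoint simplices, a matching is maximal if the union of its simplices has the maximum possible number of vertices, and $\delta(\mathcal D)_\Omega$ is the minimum cardinality of a maximal matching. If $F_1,\dots,F_s\in K[x_1,\dots,x_n]$ satisfy $\mathrm{rad}(F_1,\dots,F_s)=\mathrm{rad}(I_{L_{\mathcal G}})$, then 1. the number of distinct monomials that appear with nonzero coefficient in at least one of $F_1,\dots,F_s$ (and hence also the number counted separately for each $F_i$ and summed) is at least the number of vertices of $\mathcal D_{\mathcal G}^{\mathcal G}$; and 2. the sum over $i=1,\dots,s$ of the number of nonzero $\mathcal F$-homogeneous components of $F_i$ is at least $\delta(\mathcal D_{\mathcal F}^{\mathcal G})_\Omega$. -/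

import Mathlib

open MvPolynomial

noncomputable section

namespace LatticeIdeal

/-! ### Gradings and lattice ideals -/

/-- The degree map `ℤⁿ → M`, `u ↦ u₁ g₁ + ⋯ + uₙ gₙ`. -/
def degMap {n : ℕ} {M : Type*} [AddCommGroup M] (g : Fin n → M) : (Fin n → ℤ) →ₗ[ℤ] M :=
  Fintype.linearCombination ℤ g

/-- The lattice of integer relations of `g₁, …, gₙ`. -/
def relationLattice {n : ℕ} {M : Type*} [AddCommGroup M] (g : Fin n → M) :
    Submodule ℤ (Fin n → ℤ) :=
  LinearMap.ker (degMap g)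

/-- The saturation `{α : d α ∈ L for some nonzero integer d}`. -/
def saturation {n : ℕ} (L : Submodule ℤ (Fin n → ℤ)) : Set (Fin n → ℤ) :=
  {α | ∃ d : ℤ, d ≠ 0 ∧ d • α ∈ L}

/-- The positive part of `α`, as an exponent vector; the negative part is that of `-α`. -/
def posPart {n : ℕ} (α : Fin n → ℤ) : Fin n →₀ ℕ :=
  Finsupp.equivFunOnFinite.symm fun i => (α i).toNat

/-- The lattice ideal `(x^{α₊} - x^{α₋} : α ∈ L)` of `K[x₁, …, xₙ]`. -/
def latticeIdeal (K : Type*) [Field K] {n : ℕ} (L : Submodule ℤ (Fin n → ℤ)) :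
    Ideal (MvPolynomial (Fin n) K) :=
  Ideal.span {P | ∃ α ∈ L, P = monomial (posPart α) 1 - monomial (posPart (-α)) 1}

/-- All monomials of `P` have the same degree. -/
def IsHomogeneousPoly {K : Type*} [Field K] {n : ℕ} {M : Type*} [AddCommGroup M]
    (g : Fin n → M) (P : MvPolynomial (Fin n) K) : Prop :=
  ∃ d : M, IsWeightedHomogeneous g P d

/-- The ideal `J` is generated by homogeneous polynomials. -/
def IsHomogeneousIdeal {K : Type*} [Field K] {n : ℕ} {M : Type*} [AddCommGroup M]
    (g : Fin n → M) (J : Ideal (MvPolynomial (Fin n) K)) : Prop :=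
  ∃ S : Set (MvPolynomial (Fin n) K), (∀ P ∈ S, IsHomogeneousPoly g P) ∧ J = Ideal.span S

/-- The grading by `f` is a specialization of the grading by `g`. -/
def IsSpecialization (K : Type*) [Field K] {n : ℕ} {M N : Type*} [AddCommGroup M]
    [AddCommGroup N] (f : Fin n → M) (g : Fin n → N) : Prop :=
  ∀ J : Ideal (MvPolynomial (Fin n) K), IsHomogeneousIdeal g J → IsHomogeneousIdeal f J

/-- The grading is positive: `L ∩ ℕⁿ = {0}`. -/
def IsPositiveGrading {n : ℕ} {M : Type*} [AddCommGroup M] (g : Fin n → M) : Prop :=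
  ∀ u ∈ relationLattice g, (∀ i, 0 ≤ u i) → u = 0

/-- The number of nonzero homogeneous components of `P`. -/
def numComponents {K : Type*} [Field K] {n : ℕ} {M : Type*} [AddCommGroup M]
    (f : Fin n → M) (P : MvPolynomial (Fin n) K) : ℕ :=
  {d : M | weightedHomogeneousComponent f d P ≠ 0}.ncard

/-! ### Rational cones -/

/-- An integer vector as a rational vector. -/
def toRat {m : ℕ} (v : Fin m → ℤ) : Fin m → ℚ := fun i => (v i : ℚ)

/-- The cone `pos_ℚ(vᵢ : i ∈ s)`. -/
def posCone {ι : Type*} {m : ℕ} (s : Finset ι) (v : ι → Fin m → ℚ) : Set (Fin m → ℚ) :=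
  {x | ∃ d : ι → ℚ, (∀ i ∈ s, 0 ≤ d i) ∧ x = ∑ i ∈ s, d i • v i}

/-- The relative interior of `pos_ℚ(vᵢ : i ∈ s)`: all combinations of the generators with
positive rational coefficients. -/
def relintCone {ι : Type*} {m : ℕ} (s : Finset ι) (v : ι → Fin m → ℚ) : Set (Fin m → ℚ) :=
  {x | ∃ d : ι → ℚ, (∀ i ∈ s, 0 < d i) ∧ x = ∑ i ∈ s, d i • v i}

/-- `T` is a face of the cone `C`. -/
def IsFace {m : ℕ} (C T : Set (Fin m → ℚ)) : Prop :=
  ∃ c : Fin m → ℚ, (∀ x ∈ C, 0 ≤ c ⬝ᵥ x) ∧ T = {x ∈ C | c ⬝ᵥ x = 0}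

/-- `T` is an extreme ray, that is, a one-dimensional face, of the cone `C`. -/
def IsExtremeRay {m : ℕ} (C T : Set (Fin m → ℚ)) : Prop :=
  IsFace C T ∧ Module.finrank ℚ (Submodule.span ℚ T) = 1

/-- The cone `σ = pos_ℚ(a₁, …, aₙ)`. -/
def sigma {n m : ℕ} (A : Fin n → Fin m → ℤ) : Set (Fin m → ℚ) :=
  posCone Finset.univ fun i => toRat (A i)

/-- `r₁, …, r_t` are extreme vectors of `σ`: integer vectors, exactly one on each extreme ray. -/
def IsExtremeVectors {n m t : ℕ} (A : Fin n → Fin m → ℤ) (r : Fin t → Fin m → ℤ) : Prop :=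
  (∀ j, IsExtremeRay (sigma A) (posCone {j} fun k => toRat (r k))) ∧
    ∀ T, IsExtremeRay (sigma A) T → ∃! j, T = posCone {j} fun k => toRat (r k)

/-- The subcone `σ(E) = pos_ℚ(rⱼ : j ∈ E)`. -/
def subcone {m t : ℕ} (r : Fin t → Fin m → ℤ) (E : Finset (Fin t)) : Set (Fin m → ℚ) :=
  posCone E fun j => toRat (r j)

/-- `σ(E)` is minimal among the subcones of `σ` that are not faces of `σ`. -/
def IsMinimalNonFace {n m t : ℕ} (A : Fin n → Fin m → ℤ) (r : Fin t → Fin m → ℤ)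
    (E : Finset (Fin t)) : Prop :=
  ¬ IsFace (sigma A) (subcone r E) ∧
    ∀ E' : Finset (Fin t), ¬ IsFace (sigma A) (subcone r E') →
      subcone r E' ⊆ subcone r E → subcone r E' = subcone r E

open Classical in
/-- The projection of cones `π : σ_A → σ_B`, `π(aᵢ) = bᵢ`, given by a linear map of the ambient
spaces. Such a map exists as soon as every relation of `A` is a relation of `B`, and its values on
`σ_A` are then determined. -/
def coneProjection {n m q : ℕ} (A : Fin n → Fin m → ℤ) (B : Fin n → Fin q → ℤ) :
    (Fin m → ℚ) →ₗ[ℚ] (Fin q → ℚ) :=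
  if h : ∃ p : (Fin m → ℚ) →ₗ[ℚ] (Fin q → ℚ), ∀ i, p (toRat (A i)) = toRat (B i)
  then h.choose else 0

theorem toRat_sum {n m : ℕ} (A : Fin n → Fin m → ℤ) (z : Fin n → ℤ) :
    ∑ i, (z i : ℚ) • toRat (A i) = toRat (degMap A z) := by
  ext k
  simp [degMap, Fintype.linearCombination_apply, toRat, Finset.sum_apply]

theorem coneProjection_apply {n m q : ℕ} (A : Fin n → Fin m → ℤ) (B : Fin n → Fin q → ℤ)
    (h : relationLattice A ≤ relationLattice B) (i : Fin n) :
    coneProjection A B (toRat (A i)) = toRat (B i) := by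
  have key : ∃ p : (Fin m → ℚ) →ₗ[ℚ] (Fin q → ℚ), ∀ i, p (toRat (A i)) = toRat (B i) := by
    let α := Fintype.linearCombination ℚ fun i => toRat (A i)
    let β := Fintype.linearCombination ℚ fun i => toRat (B i)
    have hker : LinearMap.ker α ≤ LinearMap.ker β := by
      intro d hd
      obtain ⟨⟨N, hN⟩, hz⟩ := IsLocalization.exist_integer_multiples_of_finset
        (nonZeroDivisors ℤ) (Finset.univ.image d)
      have hN0 : (N : ℚ) ≠ 0 := by exact_mod_cast nonZeroDivisors.ne_zero hN
      have hz' : ∀ i, ∃ z : ℤ, (z : ℚ) = (N : ℚ) * d i := by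
        intro i
        obtain ⟨z, hz⟩ := hz (d i) (by simp)
        exact ⟨z, by simpa using hz⟩
      choose z hz using hz'
      have scale : ∀ {l : ℕ} (C : Fin n → Fin l → ℤ),
          toRat (degMap C z) = (N : ℚ) • Fintype.linearCombination ℚ (fun i => toRat (C i)) d := by
        intro l C
        rw [← toRat_sum, Fintype.linearCombination_apply, Finset.smul_sum]
        exact Finset.sum_congr rfl fun i _ => by rw [hz, mul_smul]
      have hA : z ∈ relationLattice A := by
        have h1 := scale A
        rw [show Fintype.linearCombination ℚ (fun i => toRat (A i)) d = 0 from hd, smul_zero] at h1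
        rw [relationLattice, LinearMap.mem_ker]
        ext k
        have := congrFun h1 k
        simpa [toRat] using this
      have hB : degMap B z = 0 := h hA
      have h2 := scale B
      rw [hB] at h2
      have h3 : (N : ℚ) • Fintype.linearCombination ℚ (fun i => toRat (B i)) d = 0 := by
        rw [← h2]; ext k; simp [toRat]
      exact (smul_eq_zero.mp h3).resolve_left hN0
    obtain ⟨p, hp⟩ := LinearMap.exists_extend
      (((LinearMap.ker α).liftQ β hker).comp α.quotKerEquivRange.symm.toLinearMap)
    refine ⟨p, fun i => ?_⟩
    have hα : α (Pi.single i 1) = toRat (A i) := by simp [α, Fintype.linearCombination_apply]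
    have hβ : β (Pi.single i 1) = toRat (B i) := by simp [β, Fintype.linearCombination_apply]
    have h1 := LinearMap.congr_fun hp ⟨α (Pi.single i 1), LinearMap.mem_range_self _ _⟩
    have h2 : α.quotKerEquivRange.symm ⟨α (Pi.single i 1), LinearMap.mem_range_self _ _⟩
        = (LinearMap.ker α).mkQ (Pi.single i 1) := by
      rw [LinearEquiv.symm_apply_eq]; rfl
    simp only [LinearMap.comp_apply, LinearEquiv.coe_coe, h2] at h1
    rw [← hα, ← hβ]
    simpa using h1
  rw [coneProjection, dif_pos key]
  exact key.choose_spec i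

/-! ### Simplicial complexes -/

/-- The set of vertices of a simplicial complex. -/
def vertices {V : Type*} (D : PreAbstractSimplicialComplex V) : Set V :=
  {v | {v} ∈ D.faces}

/-- A set of pairwise disjoint simplices of `D`. -/
def IsMatching {V : Type*} (D : PreAbstractSimplicialComplex V) (M : Finset (Finset V)) : Prop :=
  (∀ T ∈ M, T ∈ D.faces) ∧ (M : Set (Finset V)).PairwiseDisjoint id

/-- A matching whose support has the maximum possible cardinality. -/
def IsMaximalMatching {V : Type*} [DecidableEq V] (D : PreAbstractSimplicialComplex V)
    (M : Finset (Finset V)) : Prop :=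
  IsMatching D M ∧
    ∀ M' : Finset (Finset V), IsMatching D M' → (M'.biUnion id).card ≤ (M.biUnion id).card

/-- The minimum cardinality `δ(D)_Ω` of a maximal matching; as `V` is finite, there is one. -/
def delta {V : Type*} [Fintype V] [DecidableEq V] (D : PreAbstractSimplicialComplex V) : ℕ :=
  sInf {k | ∃ M : Finset (Finset V), IsMaximalMatching D M ∧ M.card = k}

/-- The simplicial complex attached to the cones `σ_A` and `σ_B` and the extreme vectors `r` of
`σ_A`. Its vertices are the sets `E` for which `σ(E)` is a minimal non-face of `σ_A`; a nonempty set
`T` of them is a simplex if the relative interiors of the cones `π(σ(E)) = pos_ℚ(π(rⱼ) : j ∈ E)`,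
`E ∈ T`, have a common point. -/
def complexD {n m q t : ℕ} (A : Fin n → Fin m → ℤ) (B : Fin n → Fin q → ℤ)
    (r : Fin t → Fin m → ℤ) : PreAbstractSimplicialComplex (Finset (Fin t)) where
  faces := {T | T.Nonempty ∧ (∀ E ∈ T, IsMinimalNonFace A r E) ∧
    (⋂ E ∈ T, relintCone E fun j => coneProjection A B (toRat (r j))).Nonempty}
  isRelLowerSet_faces := by
    rintro T ⟨h1, h2, x, hx⟩
    refine ⟨h1, fun T' hT' hn => ⟨hn, fun E hE => h2 E (hT' hE), x, ?_⟩⟩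
    simp only [Set.mem_iInter] at hx ⊢
    exact fun E hE => hx E (hT' hE)

theorem vertices_complexD {n m q t : ℕ} (A : Fin n → Fin m → ℤ) (B : Fin n → Fin q → ℤ)
    (r : Fin t → Fin m → ℤ) : vertices (complexD A B r) = {E | IsMinimalNonFace A r E} := by
  ext E
  constructor
  · intro h
    exact h.2.1 E (by simp)
  · intro h
    refine ⟨by simp, by simpa using h, ?_⟩
    simp only [Finset.mem_singleton, Set.iInter_iInter_eq_left]
    exact ⟨_, fun _ => 1, by simp, rfl⟩

end LatticeIdeal

end

/-! Faces of σ turn into vanishing conditions at points with coordinates 0 and 1. For a face σ(S),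
the point that is 1 at the variables with degree in σ(S) and 0 elsewhere is a zero of the lattice
ideal: both monomials of a generating binomial have the same degree, and a degree lies in a face
exactly when the degrees of its variables do. For a minimal non-face σ(E), consider the point that
is 1 at the variables with degree in some σ(S), S a proper subset of E. It is not a zero: as σ(E) is
not a face, Farkas' lemma yields a relation with generators on the rays of E on one side and a
generator outside σ(E) on the other (`exists_eval_indicatorPoint_ne_zero`).

Polynomials generating the ideal up to radical vanish at the face points but not all at this
boundary point. Since every σ(S) with S a proper subset of E is a face, inclusion-exclusion over
these S forces one of the polynomials to contain a monomial in boundary variables whose degree is in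
the relative interior of σ(E) (`exists_interiorMonomial`).

Such a monomial determines E (`IsInteriorMonomial.subset`), which gives the first bound. For the
second, group the vertices E by the index of the polynomial and the ℱ-degree of the chosen monomial.
Within a group the projected degrees coincide and lie in the relative interior of every π(σ(E)), so
each nonempty group is a simplex. The groups partition the vertices, hence form a maximal matching,
and each one uses up a nonzero ℱ-homogeneous component (`delta_le_card`). -/

namespace LatticeIdeal

/-! ### Farkas' lemma and faces of rational cones -/

section Cones

variable {ι : Type*} {m : ℕ}

theorem mem_posCone_of_mem {s : Finset ι} (v : ι → Fin m → ℚ) {i : ι} (hi : i ∈ s) :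
    v i ∈ posCone s v := by
  classical
  refine ⟨fun k => if k = i then 1 else 0, fun k _ => by dsimp only; split_ifs <;> simp, ?_⟩
  simp [ite_smul, hi]

theorem posCone_mono {s s' : Finset ι} (h : s ⊆ s') (v : ι → Fin m → ℚ) :
    posCone s v ⊆ posCone s' v := by
  classical
  rintro x ⟨d, hd, rfl⟩
  refine ⟨fun k => if k ∈ s then d k else 0, fun k _ => ?_, ?_⟩
  · dsimp only
    split_ifs with hk
    exacts [hd k hk, le_rfl]
  · simp only [ite_smul, zero_smul]
    rw [Finset.sum_ite_mem, Finset.inter_eq_right.mpr h]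

theorem add_mem_posCone {s : Finset ι} {v : ι → Fin m → ℚ} {x y : Fin m → ℚ}
    (hx : x ∈ posCone s v) (hy : y ∈ posCone s v) : x + y ∈ posCone s v := by
  obtain ⟨d, hd, rfl⟩ := hx
  obtain ⟨e, he, rfl⟩ := hy
  exact ⟨fun i => d i + e i, fun i hi => add_nonneg (hd i hi) (he i hi), by
    simp [add_smul, Finset.sum_add_distrib]⟩

theorem smul_mem_posCone {s : Finset ι} {v : ι → Fin m → ℚ} {x : Fin m → ℚ} {c : ℚ}
    (hc : 0 ≤ c) (hx : x ∈ posCone s v) : c • x ∈ posCone s v := by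
  obtain ⟨d, hd, rfl⟩ := hx
  exact ⟨fun i => c * d i, fun i hi => mul_nonneg hc (hd i hi), by
    simp [mul_smul, Finset.smul_sum]⟩

theorem zero_mem_posCone (s : Finset ι) (v : ι → Fin m → ℚ) : (0 : Fin m → ℚ) ∈ posCone s v :=
  ⟨0, by simp, by simp⟩

theorem sum_smul_mem_posCone {κ : Type*} {s : Finset ι} {v : ι → Fin m → ℚ} (u : Finset κ)
    (d : κ → ℚ) (w : κ → Fin m → ℚ) (hd : ∀ k ∈ u, 0 ≤ d k)
    (hw : ∀ k ∈ u, 0 < d k → w k ∈ posCone s v) : ∑ k ∈ u, d k • w k ∈ posCone s v := by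
  refine Finset.sum_induction _ (· ∈ posCone s v) (fun _ _ => add_mem_posCone)
    (zero_mem_posCone s v) fun k hk => ?_
  rcases (hd k hk).eq_or_lt with h | h
  · rw [← h, zero_smul]
    exact zero_mem_posCone s v
  · exact smul_mem_posCone h.le (hw k hk h)

theorem dotProduct_sum_smul (c : Fin m → ℚ) (s : Finset ι) (d : ι → ℚ) (v : ι → Fin m → ℚ) :
    c ⬝ᵥ ∑ i ∈ s, d i • v i = ∑ i ∈ s, d i * (c ⬝ᵥ v i) := by
  simp [dotProduct_sum]

/-- **Farkas' lemma** for finitely generated rational cones. -/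
theorem farkas (s : Finset ι) (v : ι → Fin m → ℚ) (b : Fin m → ℚ)
    (h : ∀ c : Fin m → ℚ, (∀ i ∈ s, 0 ≤ c ⬝ᵥ v i) → 0 ≤ c ⬝ᵥ b) : b ∈ posCone s v := by
  classical
  induction s using Finset.induction_on generalizing v b with
  | empty =>
    have h1 := h (-b) (by simp)
    have h2 : b ⬝ᵥ b = 0 := by
      refine le_antisymm (by simpa using h1) ?_
      exact Finset.sum_nonneg fun i _ => mul_self_nonneg (b i)
    rw [dotProduct_self_eq_zero.mp h2]
    exact zero_mem_posCone _ _
  | insert k s hk ih =>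
    -- Either `v k` is not needed, or some functional separates `b` from the other generators; that
    -- functional must be negative on `v k`.
    by_cases hs : ∀ c : Fin m → ℚ, (∀ i ∈ s, 0 ≤ c ⬝ᵥ v i) → 0 ≤ c ⬝ᵥ b
    · exact posCone_mono (Finset.subset_insert k s) v (ih v b hs)
    push Not at hs
    obtain ⟨x, hx, hxb⟩ := hs
    have hxk : x ⬝ᵥ v k < 0 := by
      by_contra hc
      exact absurd (h x (by simpa using ⟨not_lt.mp hc, hx⟩)) (not_le.mpr hxb)
    obtain ⟨y, hy, hyb, hyk⟩ : ∃ y : Fin m → ℚ, (∀ i ∈ s, 0 ≤ y ⬝ᵥ v i) ∧ y ⬝ᵥ b < 0 ∧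
        y ⬝ᵥ v k = -1 := by
      have hp : 0 < (-(x ⬝ᵥ v k))⁻¹ := by rw [inv_pos]; linarith
      refine ⟨(-(x ⬝ᵥ v k))⁻¹ • x, fun i hi => ?_, ?_, ?_⟩
      · rw [smul_dotProduct]; exact mul_nonneg hp.le (hx i hi)
      · rw [smul_dotProduct]; exact mul_neg_of_pos_of_neg hp hxb
      · rw [smul_dotProduct, smul_eq_mul]
        rw [inv_neg, neg_mul, inv_mul_cancel₀ hxk.ne]
    -- The map `u ↦ u + (y ⬝ᵥ u) • v k` is the projection along `v k` onto the hyperplane orthogonal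
    -- to `y`; the induction hypothesis is applied to the projected vectors.
    obtain ⟨d, hd, hb⟩ := ih (fun i => v i + (y ⬝ᵥ v i) • v k) (b + (y ⬝ᵥ b) • v k) (by
      intro c hc
      -- This is `c` composed with the projection; it vanishes on `v k`.
      have h1 := h (c + (c ⬝ᵥ v k) • y) (by
        intro i hi
        rw [Finset.mem_insert] at hi
        rcases hi with rfl | hi
        · simp [add_dotProduct, smul_dotProduct, hyk]
        · have := hc i hi
          simp only [dotProduct_add, dotProduct_smul, add_dotProduct, smul_dotProduct,
            smul_eq_mul] at this ⊢
          linarith)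
      simp only [dotProduct_add, dotProduct_smul, add_dotProduct, smul_dotProduct,
        smul_eq_mul] at h1 ⊢
      linarith)
    -- Undoing the projection leaves a multiple of `v k`, with nonnegative coefficient because `y`
    -- is nonnegative on the `v i` and negative on `b`.
    have hb' : b = (∑ i ∈ s, d i • v i) + (∑ i ∈ s, d i * (y ⬝ᵥ v i) - y ⬝ᵥ b) • v k := by
      refine (eq_sub_of_add_eq hb).trans ?_
      simp only [smul_add, Finset.sum_add_distrib, sub_smul, Finset.sum_smul, mul_smul]
      abel
    rw [hb']
    refine add_mem_posCone (posCone_mono (Finset.subset_insert k s) v ⟨d, hd, rfl⟩)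
      (smul_mem_posCone ?_ (mem_posCone_of_mem v (Finset.mem_insert_self k s)))
    have := Finset.sum_nonneg fun i hi => mul_nonneg (hd i hi) (hy i hi)
    linarith

theorem dotProduct_eq_zero_of_sum {s : Finset ι} {d : ι → ℚ} {v : ι → Fin m → ℚ}
    {c : Fin m → ℚ} (hd : ∀ i ∈ s, 0 ≤ d i) (hv : ∀ i ∈ s, 0 ≤ c ⬝ᵥ v i)
    (h : c ⬝ᵥ ∑ i ∈ s, d i • v i = 0) {i : ι} (hi : i ∈ s) (hdi : 0 < d i) : c ⬝ᵥ v i = 0 := by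
  rw [dotProduct_sum_smul,
    Finset.sum_eq_zero_iff_of_nonneg fun i hi => mul_nonneg (hd i hi) (hv i hi)] at h
  exact (mul_eq_zero.mp (h i hi)).resolve_left hdi.ne'

/-- A summand with positive coefficient of a point of a face lies in the face. -/
theorem IsFace.mem_of_sum_mem {C T : Set (Fin m → ℚ)} (hT : IsFace C T) {s : Finset ι}
    {d : ι → ℚ} {v : ι → Fin m → ℚ} (hd : ∀ i ∈ s, 0 ≤ d i) (hv : ∀ i ∈ s, v i ∈ C)
    (h : ∑ i ∈ s, d i • v i ∈ T) {i : ι} (hi : i ∈ s) (hdi : 0 < d i) : v i ∈ T := by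
  obtain ⟨c, hc, rfl⟩ := hT
  exact ⟨hv i hi, dotProduct_eq_zero_of_sum hd (fun i hi => hc _ (hv i hi)) h.2 hi hdi⟩

/-- If all generators of a cone that lie in the smallest face containing `x` lie in a
subcone `D` of that face, then `D` is this face. -/
theorem isFace_of_forall_mem {κ : Type*} [Fintype ι] (v : ι → Fin m → ℚ) (s : Finset κ)
    (w : κ → Fin m → ℚ) (hw : ∀ k ∈ s, w k ∈ posCone Finset.univ v) {e : κ → ℚ}
    (he : ∀ k ∈ s, 0 < e k)
    (h : ∀ i, ∀ a : ℚ, 0 ≤ a → a • (∑ k ∈ s, e k • w k) - v i ∈ posCone Finset.univ v →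
      v i ∈ posCone s w) :
    IsFace (posCone Finset.univ v) (posCone s w) := by
  classical
  set x := ∑ k ∈ s, e k • w k with hx
  have hxC : x ∈ posCone Finset.univ v :=
    sum_smul_mem_posCone s e w (fun k hk => (he k hk).le) fun k hk _ => hw k hk
  have key : ∀ i, ∃ c : Fin m → ℚ, (∀ k, 0 ≤ c ⬝ᵥ v k) ∧ c ⬝ᵥ x = 0 ∧
      (c ⬝ᵥ v i = 0 → v i ∈ posCone s w) := by
    intro i
    by_cases hi : v i ∈ posCone s w
    · exact ⟨0, by simp, by simp, fun _ => hi⟩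
    -- Membership would put `a • x - v i` into the cone, `a` being the coefficient of `-x`.
    -- Including `-x` among the generators forces the separating functional to vanish at `x`.
    have hn : -v i ∉ posCone (Finset.univ : Finset (Option ι)) (fun o => o.elim (-x) v) := by
      rintro ⟨d, hd, hsum⟩
      rw [Fintype.sum_option] at hsum
      refine hi (h i (d none) (hd none (Finset.mem_univ _))
        ⟨fun k => d (some k), fun k _ => hd _ (Finset.mem_univ _), ?_⟩)
      simp only [Option.elim] at hsum
      rw [sub_eq_add_neg, hsum]
      simp
    have := mt (farkas _ _ _) hn
    push Not at this
    obtain ⟨c, hc, hci⟩ := this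
    have hcv : ∀ k, 0 ≤ c ⬝ᵥ v k := fun k => hc (some k) (Finset.mem_univ _)
    have hcx : c ⬝ᵥ -x ≥ 0 := hc none (Finset.mem_univ _)
    refine ⟨c, hcv, le_antisymm (by simpa using hcx) ?_, fun h0 => ?_⟩
    · obtain ⟨d, hd, hdx⟩ := hxC
      rw [hdx, dotProduct_sum_smul]
      exact Finset.sum_nonneg fun k hk => mul_nonneg (hd k hk) (hcv k)
    · rw [dotProduct_neg, h0] at hci
      simp at hci
  choose c hcv hcx hci using key
  -- The sum of these functionals cuts out the face: being nonnegative on the cone, they all vanish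
  -- wherever their sum does.
  have hC : ∀ k, 0 ≤ (∑ i, c i) ⬝ᵥ v k := fun k => by
    rw [sum_dotProduct]
    exact Finset.sum_nonneg fun i _ => hcv i k
  have hCx : (∑ i, c i) ⬝ᵥ x = 0 := by
    rw [sum_dotProduct]
    exact Finset.sum_eq_zero fun i _ => hcx i
  have hCC : ∀ y ∈ posCone Finset.univ v, 0 ≤ (∑ i, c i) ⬝ᵥ y := by
    rintro _ ⟨d, hd, rfl⟩
    rw [dotProduct_sum_smul]
    exact Finset.sum_nonneg fun k hk => mul_nonneg (hd k hk) (hC k)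
  refine ⟨∑ i, c i, hCC, Set.Subset.antisymm ?_ ?_⟩
  · rintro _ ⟨d, hd, rfl⟩
    refine ⟨sum_smul_mem_posCone s d w hd fun k hk _ => hw k hk, ?_⟩
    rw [dotProduct_sum_smul]
    refine Finset.sum_eq_zero fun k hk => ?_
    rw [dotProduct_eq_zero_of_sum (fun k hk => (he k hk).le) (fun k hk => hCC _ (hw k hk))
      hCx hk (he k hk), mul_zero]
  · rintro _ ⟨⟨d, hd, rfl⟩, h0⟩
    refine sum_smul_mem_posCone _ d v hd fun i hi hdi => hci i ?_
    have h1 := dotProduct_eq_zero_of_sum hd (fun k _ => hC k) h0 hi hdi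
    rw [sum_dotProduct, Finset.sum_eq_zero_iff_of_nonneg fun k _ => hcv k i] at h1
    exact h1 i (Finset.mem_univ i)

end Cones

/-! ### Extreme vectors and minimal non-faces -/

section MinimalNonFaces

variable {n m t : ℕ} {A : Fin n → Fin m → ℤ} {r : Fin t → Fin m → ℤ}

theorem IsExtremeVectors.mem_sigma (hr : IsExtremeVectors A r) (j : Fin t) :
    toRat (r j) ∈ sigma A := by
  obtain ⟨⟨c, hc, hT⟩, -⟩ := hr.1 j
  have h := mem_posCone_of_mem (fun k => toRat (r k)) (Finset.mem_singleton_self j)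
  rw [hT] at h
  exact h.1

theorem IsExtremeVectors.ne_zero (hr : IsExtremeVectors A r) (j : Fin t) : toRat (r j) ≠ 0 := by
  intro h0
  have h := (hr.1 j).2
  have hs : Submodule.span ℚ (posCone {j} fun k => toRat (r k)) = ⊥ := by
    rw [Submodule.span_eq_bot]
    rintro _ ⟨d, -, rfl⟩
    simp [h0]
  rw [hs, finrank_bot] at h
  exact zero_ne_one h

theorem mem_posCone_singleton {ι : Type*} {v : ι → Fin m → ℚ} {j : ι} {x : Fin m → ℚ} :
    x ∈ posCone {j} v ↔ ∃ a : ℚ, 0 ≤ a ∧ x = a • v j := by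
  constructor
  · rintro ⟨d, hd, rfl⟩
    exact ⟨d j, hd j (Finset.mem_singleton_self j), by simp⟩
  · rintro ⟨a, ha, rfl⟩
    exact smul_mem_posCone ha (mem_posCone_of_mem v (Finset.mem_singleton_self j))

/-- The ray of `r k` is a face, so it contains some `r j` that occurs with positive coefficient. The
two rays then coincide, and each extreme ray carries only one `r j`. -/
theorem IsExtremeVectors.mem_of_mem_subcone (hr : IsExtremeVectors A r) {k : Fin t}
    {S : Finset (Fin t)} (h : toRat (r k) ∈ subcone r S) : k ∈ S := by
  obtain ⟨d, hd, hk⟩ := h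
  obtain ⟨j, hj, hdj⟩ : ∃ j ∈ S, 0 < d j := by
    by_contra! hc
    refine hr.ne_zero k (hk.trans (Finset.sum_eq_zero fun j hj => ?_))
    rw [le_antisymm (hc j hj) (hd j hj), zero_smul]
  have hjk : toRat (r j) ∈ posCone {k} fun k => toRat (r k) := by
    refine (hr.1 k).1.mem_of_sum_mem (v := fun j => toRat (r j)) hd
      (fun j _ => hr.mem_sigma j) ?_ hj hdj
    rw [← hk]
    exact mem_posCone_of_mem (fun k => toRat (r k)) (Finset.mem_singleton_self k)
  obtain ⟨a, ha, haj⟩ := mem_posCone_singleton.mp hjk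
  have ha0 : 0 < a := by
    refine lt_of_le_of_ne ha fun h0 => hr.ne_zero j ?_
    rw [haj, ← h0, zero_smul]
  have heq : (posCone {k} fun k => toRat (r k)) = posCone {j} fun k => toRat (r k) := by
    ext x
    rw [mem_posCone_singleton, mem_posCone_singleton]
    constructor
    · rintro ⟨b, hb, rfl⟩
      exact ⟨b * a⁻¹, by positivity, by rw [haj, smul_smul, inv_mul_cancel_right₀ ha0.ne']⟩
    · rintro ⟨b, hb, rfl⟩
      exact ⟨b * a, by positivity, by rw [haj, smul_smul]⟩
  rwa [(hr.2 _ (hr.1 k)).unique rfl heq]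

/-- Every extreme ray contains one of the generators of the cone. -/
theorem IsExtremeVectors.exists_generator (hr : IsExtremeVectors A r) (j : Fin t) :
    ∃ i, ∃ a : ℚ, 0 < a ∧ toRat (A i) = a • toRat (r j) := by
  obtain ⟨d, hd, hj⟩ := hr.mem_sigma j
  obtain ⟨i, hdi, hi0⟩ : ∃ i, 0 < d i ∧ toRat (A i) ≠ 0 := by
    by_contra! hc
    refine hr.ne_zero j (hj.trans (Finset.sum_eq_zero fun i hi => ?_))
    rcases (hd i hi).eq_or_lt with h | h
    · rw [← h, zero_smul]
    · simp only [hc i h, smul_zero]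
  have hij : toRat (A i) ∈ posCone {j} fun k => toRat (r k) := by
    refine (hr.1 j).1.mem_of_sum_mem (v := fun i => toRat (A i)) hd
      (fun i hi => mem_posCone_of_mem _ hi) ?_ (Finset.mem_univ i) hdi
    rw [← hj]
    exact mem_posCone_of_mem (fun k => toRat (r k)) (Finset.mem_singleton_self j)
  obtain ⟨a, ha, hai⟩ := mem_posCone_singleton.mp hij
  refine ⟨i, a, lt_of_le_of_ne ha fun h0 => hi0 ?_, hai⟩
  rw [hai, ← h0, zero_smul]

theorem IsMinimalNonFace.isFace_of_ssubset {E S : Finset (Fin t)} (hE : IsMinimalNonFace A r E)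
    (hr : IsExtremeVectors A r) (hS : S ⊂ E) : IsFace (sigma A) (subcone r S) := by
  by_contra h
  have heq := hE.2 S h (posCone_mono hS.1 _)
  refine hS.2 fun j hj => hr.mem_of_mem_subcone ?_
  rw [heq]
  exact mem_posCone_of_mem (fun j => toRat (r j)) hj

theorem IsMinimalNonFace.singleton_ssubset {E : Finset (Fin t)} (hE : IsMinimalNonFace A r E)
    (hr : IsExtremeVectors A r) {j : Fin t} (hj : j ∈ E) : {j} ⊂ E := by
  refine lt_of_le_of_ne (Finset.singleton_subset_iff.mpr hj) ?_
  rintro rfl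
  exact hE.1 (hr.1 j).1

/-- Up to scaling, `c` is dual to the extreme vectors `rⱼ`, `j ∈ E`. -/
def IsDualFamily (A : Fin n → Fin m → ℤ) (r : Fin t → Fin m → ℤ) (E : Finset (Fin t))
    (c : Fin t → Fin m → ℚ) : Prop :=
  ∀ j ∈ E, (∀ x ∈ sigma A, 0 ≤ c j ⬝ᵥ x) ∧ 0 < c j ⬝ᵥ toRat (r j) ∧
    ∀ k ∈ E, k ≠ j → c j ⬝ᵥ toRat (r k) = 0

/-- The generators of a minimal non-face admit a dual family: the proper subcones are faces. -/
theorem IsMinimalNonFace.exists_isDualFamily {E : Finset (Fin t)}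
    (hE : IsMinimalNonFace A r E) (hr : IsExtremeVectors A r) : ∃ c, IsDualFamily A r E c := by
  have key : ∀ j, ∃ c : Fin m → ℚ, j ∈ E → (∀ x ∈ sigma A, 0 ≤ c ⬝ᵥ x) ∧
      0 < c ⬝ᵥ toRat (r j) ∧ ∀ k ∈ E, k ≠ j → c ⬝ᵥ toRat (r k) = 0 := by
    intro j
    by_cases hj : j ∈ E
    · obtain ⟨c, hc, hT⟩ := hE.isFace_of_ssubset hr (Finset.erase_ssubset hj)
      refine ⟨c, fun _ => ⟨hc, ?_, fun k hk hkj => ?_⟩⟩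
      · refine lt_of_le_of_ne (hc _ (hr.mem_sigma j)) fun h0 => ?_
        have : toRat (r j) ∈ subcone r (E.erase j) := by
          rw [hT]
          exact ⟨hr.mem_sigma j, h0.symm⟩
        exact Finset.notMem_erase j E (hr.mem_of_mem_subcone this)
      · have : toRat (r k) ∈ subcone r (E.erase j) :=
          mem_posCone_of_mem (fun j => toRat (r j)) (Finset.mem_erase.mpr ⟨hkj, hk⟩)
        rw [hT] at this
        exact this.2
    · exact ⟨0, fun h => absurd h hj⟩
  choose c hc using key
  exact ⟨c, hc⟩

theorem IsDualFamily.dotProduct_sum {E : Finset (Fin t)} {c : Fin t → Fin m → ℚ}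
    (hc : IsDualFamily A r E c) {j : Fin t} (hj : j ∈ E) (d : Fin t → ℚ) :
    c j ⬝ᵥ ∑ k ∈ E, d k • toRat (r k) = d j * (c j ⬝ᵥ toRat (r j)) := by
  rw [dotProduct_sum_smul (c j) E d fun k => toRat (r k), Finset.sum_eq_single j]
  · intro k hk hkj
    rw [(hc j hj).2.2 k hk hkj, mul_zero]
  · exact fun h => absurd hj h

/-- Up to positive factors, the dual functionals read off the coefficients of `x` along the `r j`,
`j ∈ E`. -/
theorem IsDualFamily.mem_subcone_iff {E S : Finset (Fin t)} {c : Fin t → Fin m → ℚ}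
    (hc : IsDualFamily A r E c) (hS : S ⊆ E) {x : Fin m → ℚ} (hx : x ∈ subcone r E) :
    x ∈ subcone r S ↔ ∀ j ∈ E, 0 < c j ⬝ᵥ x → j ∈ S := by
  constructor
  · rintro ⟨d, hd, rfl⟩ j hj hpos
    by_contra hjS
    refine hpos.ne' ?_
    rw [dotProduct_sum_smul (c j) S d fun k => toRat (r k)]
    refine Finset.sum_eq_zero fun k hk => ?_
    rw [(hc j hj).2.2 k (hS hk) (by rintro rfl; exact hjS hk), mul_zero]
  · intro h
    obtain ⟨d, hd, rfl⟩ := hx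
    refine sum_smul_mem_posCone E d _ hd fun j hj hdj =>
      mem_posCone_of_mem (fun j => toRat (r j)) (h j hj ?_)
    rw [hc.dotProduct_sum hj]
    exact mul_pos hdj (hc j hj).2.1

theorem IsDualFamily.mem_relintCone {E : Finset (Fin t)} {c : Fin t → Fin m → ℚ}
    (hc : IsDualFamily A r E c) {x : Fin m → ℚ} (hx : x ∈ subcone r E)
    (h : ∀ j ∈ E, 0 < c j ⬝ᵥ x) : x ∈ relintCone E fun j => toRat (r j) := by
  obtain ⟨d, hd, rfl⟩ := hx
  refine ⟨d, fun j hj => ?_, rfl⟩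
  have := h j hj
  rw [hc.dotProduct_sum hj] at this
  exact pos_of_mul_pos_left this (hc j hj).2.1.le

/-- The degree of a monomial lies in a face if and only if the degrees of its variables do. -/
theorem IsFace.sum_mem_iff {S : Finset (Fin t)} (hS : IsFace (sigma A) (subcone r S))
    (w : Fin n →₀ ℕ) :
    ∑ i, (w i : ℚ) • toRat (A i) ∈ subcone r S ↔ ∀ i ∈ w.support, toRat (A i) ∈ subcone r S := by
  constructor
  · intro h i hi
    refine hS.mem_of_sum_mem (v := fun i => toRat (A i)) (d := fun i => (w i : ℚ))
      (fun _ _ => by positivity) (fun i hi => mem_posCone_of_mem _ hi) h (Finset.mem_univ i) ?_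
    exact_mod_cast Nat.pos_of_ne_zero (Finsupp.mem_support_iff.mp hi)
  · intro h
    refine sum_smul_mem_posCone _ _ _ (fun _ _ => by positivity) fun i _ hi => h i ?_
    rw [Finsupp.mem_support_iff]
    rintro h0
    simp [h0] at hi

/-- The monomial `w` only involves variables from the boundary of `σ(E)`, and its degree lies in
the relative interior of `σ(E)`. -/
def IsInteriorMonomial (A : Fin n → Fin m → ℤ) (r : Fin t → Fin m → ℤ) (E : Finset (Fin t))
    (w : Fin n →₀ ℕ) : Prop :=
  (∀ i ∈ w.support, ∃ S ⊂ E, toRat (A i) ∈ subcone r S) ∧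
    ∑ i, (w i : ℚ) • toRat (A i) ∈ relintCone E fun j => toRat (r j)

/-- For `k ∈ E'`, some variable of `w` has a degree with positive coefficient at `r k`. That degree
also lies in a proper subcone `σ(S)` of `σ(E)`, which is a face and therefore contains `r k`; so `k
∈ S ⊆ E`. By symmetry, a monomial is interior to at most one minimal non-face. -/
theorem IsInteriorMonomial.subset {E E' : Finset (Fin t)} {w : Fin n →₀ ℕ}
    (hw : IsInteriorMonomial A r E w) (hw' : IsInteriorMonomial A r E' w)
    (hE : IsMinimalNonFace A r E) (hE' : IsMinimalNonFace A r E') (hr : IsExtremeVectors A r) :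
    E' ⊆ E := by
  intro k hk
  obtain ⟨c, hc⟩ := hE'.exists_isDualFamily hr
  obtain ⟨i, hi, hik⟩ : ∃ i ∈ w.support, 0 < c k ⬝ᵥ toRat (A i) := by
    obtain ⟨d, hd, hsum⟩ := hw'.2
    have hpos : 0 < c k ⬝ᵥ ∑ i, (w i : ℚ) • toRat (A i) := by
      rw [hsum, hc.dotProduct_sum hk]
      exact mul_pos (hd k hk) (hc k hk).2.1
    rw [dotProduct_sum_smul (c k) _ (fun i => (w i : ℚ)) fun i => toRat (A i)] at hpos
    obtain ⟨i, -, hi⟩ := Finset.exists_lt_of_sum_lt (s := Finset.univ) (f := fun _ => (0 : ℚ))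
      (by simpa using hpos)
    have hwi : w i ≠ 0 := by
      rintro h0
      simp [h0] at hi
    exact ⟨i, Finsupp.mem_support_iff.mpr hwi, pos_of_mul_pos_right hi (by positivity)⟩
  obtain ⟨S, hS, hiS⟩ := hw.1 i hi
  obtain ⟨S', hS', d, hd, hiS'⟩ := hw'.1 i hi
  have hkS' : k ∈ S' := (hc.mem_subcone_iff hS'.1
    (posCone_mono hS'.1 _ ⟨d, hd, hiS'⟩)).mp ⟨d, hd, hiS'⟩ k hk hik
  have hdk : 0 < d k := by
    refine lt_of_le_of_ne (hd k hkS') fun h0 => hik.ne' ?_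
    rw [hiS', dotProduct_sum_smul (c k) S' d fun j => toRat (r j)]
    refine Finset.sum_eq_zero fun l hl => ?_
    rcases eq_or_ne l k with rfl | hlk
    · rw [← h0, zero_mul]
    · rw [(hc k hk).2.2 l (hS'.1 hl) hlk, mul_zero]
  refine hS.1 (hr.mem_of_mem_subcone ((hE.isFace_of_ssubset hr hS).mem_of_sum_mem
    (v := fun j => toRat (r j)) hd (fun j _ => hr.mem_sigma j) ?_ hkS' hdk))
  rwa [← hiS']

end MinimalNonFaces

/-! ### Interior monomials of generators up to radical -/

section Radical

variable {K : Type*} [Field K] {n : ℕ}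

open Classical in
/-- The point with coordinates `1` where `q` holds and `0` elsewhere. -/
noncomputable def indicatorPoint (K : Type*) [Field K] (q : Fin n → Prop) : Fin n → K :=
  fun i => if q i then 1 else 0

open Classical in
theorem prod_indicatorPoint_pow (q : Fin n → Prop) (w : Fin n →₀ ℕ) :
    ∏ i, indicatorPoint K q i ^ w i = if ∀ i ∈ w.support, q i then 1 else 0 := by
  split_ifs with h
  · refine Finset.prod_eq_one fun i _ => ?_
    by_cases hi : w i = 0
    · rw [hi, pow_zero]
    · simp [indicatorPoint, h i (Finsupp.mem_support_iff.mpr hi)]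
  · push Not at h
    obtain ⟨i, hi, hq⟩ := h
    refine Finset.prod_eq_zero (Finset.mem_univ i) ?_
    simp [indicatorPoint, hq, Finsupp.mem_support_iff.mp hi]

open Classical in
theorem eval_indicatorPoint_monomial (q : Fin n → Prop) (w : Fin n →₀ ℕ) :
    eval (indicatorPoint K q) (monomial w (1 : K)) = if ∀ i ∈ w.support, q i then 1 else 0 := by
  rw [eval_monomial, one_mul, ← prod_indicatorPoint_pow,
    Finsupp.prod_fintype _ _ fun i => pow_zero _]

theorem eval_indicatorPoint (q : Fin n → Prop)
    [DecidablePred fun w : Fin n →₀ ℕ => ∀ i ∈ w.support, q i] (F : MvPolynomial (Fin n) K) :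
    eval (indicatorPoint K q) F =
      ∑ w ∈ F.support with ∀ i ∈ w.support, q i, F.coeff w := by
  rw [eval_eq', Finset.sum_filter]
  refine Finset.sum_congr rfl fun w _ => ?_
  rw [prod_indicatorPoint_pow]
  split_ifs <;> simp

theorem mem_support_posPart {α : Fin n → ℤ} {i : Fin n} :
    i ∈ (posPart α).support ↔ 0 < α i := by
  rw [Finsupp.mem_support_iff]
  change (α i).toNat ≠ 0 ↔ _
  omega

theorem posPart_sub_posPart_neg (α : Fin n → ℤ) (i : Fin n) :
    ((posPart α i : ℕ) : ℤ) - (posPart (-α) i : ℕ) = α i := by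
  change (((α i).toNat : ℕ) : ℤ) - ((-α i).toNat : ℕ) = α i
  omega

/-- A polynomial in the radical of an ideal vanishes where the ideal does. -/
theorem eval_eq_zero_of_mem_radical {J : Ideal (MvPolynomial (Fin n) K)} {p : Fin n → K}
    (hJ : ∀ F ∈ J, eval p F = 0) {F : MvPolynomial (Fin n) K} (hF : F ∈ J.radical) :
    eval p F = 0 := by
  obtain ⟨k, hk⟩ := hF
  have := hJ _ hk
  rw [map_pow] at this
  exact eq_zero_of_pow_eq_zero this

theorem eval_eq_zero_of_mem_span {S : Set (MvPolynomial (Fin n) K)} {p : Fin n → K}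
    (hS : ∀ F ∈ S, eval p F = 0) : ∀ F ∈ Ideal.span S, eval p F = 0 := by
  have : Ideal.span S ≤ RingHom.ker (eval p) := Ideal.span_le.mpr fun F hF => hS F hF
  exact fun F hF => this hF

/-- If the sums of `c` over the fibres of `T` below each proper subset of `E` vanish and no fibre
lies over `E`, then the total sum vanishes. -/
theorem sum_eq_zero_of_ssubset {ι τ R : Type*} [AddCommGroup R] [DecidableEq τ] (W : Finset ι)
    (c : ι → R) (T : ι → Finset τ) (E : Finset τ) (hT : ∀ w ∈ W, T w ⊂ E)
    (h : ∀ S ⊂ E, ∑ w ∈ W with T w ⊆ S, c w = 0) : ∑ w ∈ W, c w = 0 := by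
  -- Möbius inversion by strong induction: among the fibres over subsets of `S`, all but the one
  -- over `S` itself already have sum zero.
  have fib : ∀ S ⊂ E, ∑ w ∈ W with T w = S, c w = 0 := by
    intro S
    induction S using Finset.strongInduction with
    | H S ih =>
      intro hS
      have h1 := h S hS
      rw [← Finset.sum_fiberwise_of_maps_to (t := S.powerset) (g := T)
        (fun w hw => Finset.mem_powerset.mpr (Finset.mem_filter.mp hw).2),
        Finset.sum_eq_single S] at h1
      · rw [← h1, Finset.filter_filter]
        refine Finset.sum_congr (Finset.filter_congr fun w _ => ?_) fun _ _ => rfl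
        exact ⟨fun h => ⟨h.subset, h⟩, And.right⟩
      · intro S' hS' hne
        have hss : S' ⊂ S := lt_of_le_of_ne (Finset.mem_powerset.mp hS') hne
        rw [Finset.filter_filter, ← ih S' hss (hss.trans hS)]
        refine Finset.sum_congr (Finset.filter_congr fun w _ => ?_) fun _ _ => rfl
        exact ⟨And.right, fun h => ⟨h.subset.trans hss.1, h⟩⟩
      · exact fun hn => absurd (Finset.mem_powerset_self S) hn
  rw [← Finset.sum_fiberwise_of_maps_to (t := E.ssubsets) (g := T)
    fun w hw => Finset.mem_ssubsets.mpr (hT w hw)]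
  exact Finset.sum_eq_zero fun S hS => fib S (Finset.mem_ssubsets.mp hS)

/-! ### Clearing denominators in relations, and lattice ideals at indicator points -/

theorem toRat_eq_zero {m : ℕ} {v : Fin m → ℤ} (h : toRat v = 0) : v = 0 := by
  ext k
  have := congrFun h k
  simpa [toRat] using this

/-- A rational relation of `A` is a positive multiple of a relation of the grading. -/
theorem exists_mem_relationLattice {m : ℕ} {G : Type*} [AddCommGroup G] {g : Fin n → G}
    {A : Fin n → Fin m → ℤ}
    (hA : saturation (relationLattice g) = (relationLattice A : Set (Fin n → ℤ)))
    (e : Fin n → ℚ) (he : ∑ i, e i • toRat (A i) = 0) :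
    ∃ β ∈ relationLattice g, ∃ N : ℚ, 0 < N ∧ ∀ i, (β i : ℚ) = N * e i := by
  have hz : ∀ i, ∃ z : ℤ, (z : ℚ) = (∏ k, (e k).den : ℕ) * e i := by
    intro i
    obtain ⟨u, hu⟩ := Finset.dvd_prod_of_mem (fun k => (e k).den) (Finset.mem_univ i)
    refine ⟨u * (e i).num, ?_⟩
    rw [hu]
    push_cast
    rw [mul_right_comm, mul_comm ((e i).den : ℚ), Rat.mul_den_eq_num, mul_comm]
  have hN : (0 : ℚ) < (∏ k, (e k).den : ℕ) := by
    exact_mod_cast Finset.prod_pos fun k _ => (e k).den_pos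
  choose z hz using hz
  have hzA : z ∈ relationLattice A := by
    refine toRat_eq_zero ?_
    rw [← toRat_sum]
    simp only [hz, mul_smul, ← Finset.smul_sum, he, smul_zero]
  obtain ⟨d, hd, hdz⟩ : z ∈ saturation (relationLattice g) := by rw [hA]; exact hzA
  -- The saturation provides `d` of either sign; the absolute value keeps the signs of the
  -- coefficients of `e`.
  refine ⟨|d| • z, ?_, |d| * (∏ k, (e k).den : ℕ), ?_, fun i => ?_⟩
  · rcases abs_choice d with h | h
    · rwa [h]
    · rw [h, neg_smul]
      exact neg_mem hdz
  · have : (0 : ℚ) < |(d : ℚ)| := abs_pos.mpr (by exact_mod_cast hd)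
    positivity
  · rw [mul_assoc, ← hz]
    simp

variable {m t : ℕ} {G : Type*} [AddCommGroup G] {g : Fin n → G} {A : Fin n → Fin m → ℤ}
  {r : Fin t → Fin m → ℤ}

theorem relationLattice_le_of_saturation
    (hA : saturation (relationLattice g) = (relationLattice A : Set (Fin n → ℤ))) :
    relationLattice g ≤ relationLattice A := by
  intro α hα
  have : α ∈ saturation (relationLattice g) := ⟨1, one_ne_zero, by rwa [one_smul]⟩
  rwa [hA] at this

/-- The monomials `x^{α₊}` and `x^{α₋}` have the same degree if `α` is a relation. -/
theorem sum_posPart_eq {α : Fin n → ℤ} (hα : α ∈ relationLattice A) :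
    ∑ i, (posPart α i : ℚ) • toRat (A i) = ∑ i, (posPart (-α) i : ℚ) • toRat (A i) := by
  rw [← sub_eq_zero, ← Finset.sum_sub_distrib]
  have h := toRat_sum A α
  rw [show degMap A α = 0 from hα] at h
  rw [show toRat (0 : Fin m → ℤ) = 0 by ext; simp [toRat]] at h
  rw [← h]
  refine Finset.sum_congr rfl fun i _ => ?_
  rw [← sub_smul, ← posPart_sub_posPart_neg α i]
  push_cast
  rfl

/-- The lattice ideal vanishes at the indicator point of a face. -/
theorem eval_indicatorPoint_latticeIdeal
    (hA : saturation (relationLattice g) = (relationLattice A : Set (Fin n → ℤ)))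
    {S : Finset (Fin t)} (hS : IsFace (sigma A) (subcone r S)) :
    ∀ F ∈ latticeIdeal K (relationLattice g),
      eval (indicatorPoint K fun i => toRat (A i) ∈ subcone r S) F = 0 := by
  classical
  refine eval_eq_zero_of_mem_span ?_
  rintro _ ⟨α, hα, rfl⟩
  rw [map_sub, eval_indicatorPoint_monomial, eval_indicatorPoint_monomial]
  simp only [← hS.sum_mem_iff, sum_posPart_eq (relationLattice_le_of_saturation hA hα), sub_self]

/-- The lattice ideal does not vanish at the indicator point of the boundary of a minimal
non-face. -/
theorem exists_eval_indicatorPoint_ne_zero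
    (hA : saturation (relationLattice g) = (relationLattice A : Set (Fin n → ℤ)))
    (hr : IsExtremeVectors A r) {E : Finset (Fin t)} (hE : IsMinimalNonFace A r E) :
    ∃ F ∈ latticeIdeal K (relationLattice g),
      eval (indicatorPoint K fun i => ∃ S ⊂ E, toRat (A i) ∈ subcone r S) F ≠ 0 := by
  classical
  choose ν a ha hν using hr.exists_generator
  -- With the weights `a`, the interior point of `σ(E)` is the sum of the generators `A (ν j)`, `j ∈
  -- E`.
  have hnf := mt (isFace_of_forall_mem (fun i => toRat (A i)) E (fun j => toRat (r j))
    (fun j _ => hr.mem_sigma j) (e := a) fun j _ => ha j) hE.1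
  push Not at hnf
  obtain ⟨i, b, hb, ⟨d, hd, hsum⟩, hi⟩ := hnf
  have hνE : ∀ j ∈ E, toRat (A (ν j)) ∈ subcone r {j} := fun j _ =>
    mem_posCone_singleton.mpr ⟨a j, (ha j).le, hν j⟩
  have hiν : ∀ j ∈ E, i ≠ ν j := by
    rintro j hj rfl
    exact hi (posCone_mono (Finset.singleton_subset_iff.mpr hj) _ (hνE j hj))
  -- The relation `b ∑ A (ν j) = A i + ∑ d k A k`. Its positive entries occur only at the `ν j`, on
  -- the rays of `E`, and its entry at `i` is negative, so at the boundary point the two monomials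
  -- of the binomial take the values 1 and 0.
  let e : Fin n → ℚ := fun k => (∑ j ∈ E, if k = ν j then b else 0) - (if k = i then 1 else 0) - d k
  have he : ∑ k, e k • toRat (A k) = 0 := by
    simp only [e, sub_smul, Finset.sum_sub_distrib, Finset.sum_smul, ite_smul, zero_smul, one_smul]
    rw [Finset.sum_comm]
    simp only [Finset.sum_ite_eq', Finset.mem_univ, if_true, hν, sub_eq_zero]
    rw [← hsum, Finset.smul_sum]
  obtain ⟨β, hβ, N, hN, hβe⟩ := exists_mem_relationLattice hA e he
  refine ⟨_, Ideal.subset_span ⟨β, hβ, rfl⟩, ?_⟩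
  have hi0 : β i < 0 := by
    have : (β i : ℚ) < 0 := by
      rw [hβe]
      refine mul_neg_of_pos_of_neg hN ?_
      have h1 : (∑ j ∈ E, if i = ν j then b else 0) = 0 :=
        Finset.sum_eq_zero fun j hj => if_neg (hiν j hj)
      have := hd i (Finset.mem_univ i)
      simp only [e, h1, if_true]
      linarith
    exact_mod_cast this
  have hpos : ∀ k, 0 < β k → ∃ j ∈ E, k = ν j := by
    intro k hk
    by_contra! hc
    have h1 : (∑ j ∈ E, if k = ν j then b else 0) = 0 :=
      Finset.sum_eq_zero fun j hj => if_neg (hc j hj)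
    have h2 : (0 : ℚ) < β k := by exact_mod_cast hk
    rw [hβe] at h2
    have h3 : 0 < e k := pos_of_mul_pos_right h2 hN.le
    have := hd k (Finset.mem_univ k)
    simp only [e, h1] at h3
    split_ifs at h3 <;> linarith
  rw [map_sub, eval_indicatorPoint_monomial, eval_indicatorPoint_monomial, if_pos, if_neg]
  · simp
  · intro h
    obtain ⟨S, hS, hiS⟩ := h i (mem_support_posPart.mpr (by simpa using hi0))
    exact hi (posCone_mono hS.1 _ hiS)
  · intro k hk
    obtain ⟨j, hj, rfl⟩ := hpos k (mem_support_posPart.mp hk)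
    exact ⟨{j}, hE.singleton_ssubset hr hj, hνE j hj⟩

/-- A polynomial that vanishes at the indicator points of the proper faces of a minimal non-face
and has no interior monomial vanishes at the indicator point of its boundary. -/
theorem eval_indicatorPoint_boundary (hr : IsExtremeVectors A r) {E : Finset (Fin t)}
    (hE : IsMinimalNonFace A r E) (F : MvPolynomial (Fin n) K)
    (hF : ∀ S ⊂ E, eval (indicatorPoint K fun i => toRat (A i) ∈ subcone r S) F = 0)
    (hn : ∀ w ∈ F.support, ¬ IsInteriorMonomial A r E w) :
    eval (indicatorPoint K fun i => ∃ S ⊂ E, toRat (A i) ∈ subcone r S) F = 0 := by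
  classical
  obtain ⟨c, hc⟩ := hE.exists_isDualFamily hr
  have hdeg : ∀ w : Fin n →₀ ℕ, (∀ i ∈ w.support, ∃ S ⊂ E, toRat (A i) ∈ subcone r S) →
      ∑ i, (w i : ℚ) • toRat (A i) ∈ subcone r E := by
    intro w hw
    refine sum_smul_mem_posCone _ _ _ (fun _ _ => by positivity) fun i _ hi => ?_
    have hi' : i ∈ w.support := by
      rw [Finsupp.mem_support_iff]
      rintro h0
      simp [h0] at hi
    obtain ⟨S, hS, hiS⟩ := hw i hi'
    exact posCone_mono hS.1 _ hiS
  rw [eval_indicatorPoint]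
  -- Each monomial in boundary variables is sorted by the smallest set of extreme vectors in `E`
  -- whose cone contains its degree. This set is all of `E` only for interior monomials; evaluation
  -- at the point of `σ(S)` sums the coefficients over the sets contained in `S`.
  refine sum_eq_zero_of_ssubset _ _
    (fun w => {j ∈ E | 0 < c j ⬝ᵥ ∑ i, (w i : ℚ) • toRat (A i)}) E ?_ ?_
  · intro w hw
    rw [Finset.mem_filter] at hw
    refine lt_of_le_of_ne (Finset.filter_subset _ _) fun h => hn w hw.1 ⟨hw.2, ?_⟩
    exact hc.mem_relintCone (hdeg w hw.2) fun j hj => (Finset.filter_eq_self.mp h) j hj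
  · intro S hS
    rw [← hF S hS, eval_indicatorPoint, Finset.filter_filter]
    refine Finset.sum_congr (Finset.filter_congr fun w _ => ?_) fun _ _ => rfl
    have hface := hE.isFace_of_ssubset hr hS
    constructor
    · rintro ⟨hw, hT⟩
      rw [← hface.sum_mem_iff, hc.mem_subcone_iff hS.1 (hdeg w hw)]
      exact fun j hj hpos => hT (Finset.mem_filter.mpr ⟨hj, hpos⟩)
    · intro hw
      have hw' : ∀ i ∈ w.support, ∃ S ⊂ E, toRat (A i) ∈ subcone r S :=
        fun i hi => ⟨S, hS, hw i hi⟩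
      refine ⟨hw', fun j hj => ?_⟩
      rw [← hface.sum_mem_iff, hc.mem_subcone_iff hS.1 (hdeg w hw')] at hw
      rw [Finset.mem_filter] at hj
      exact hw j hj.1 hj.2

/-- Polynomials that generate the lattice ideal up to radical contain an interior monomial for
every minimal non-face. -/
theorem exists_interiorMonomial
    (hA : saturation (relationLattice g) = (relationLattice A : Set (Fin n → ℤ)))
    (hr : IsExtremeVectors A r) {s : ℕ} {P : Fin s → MvPolynomial (Fin n) K}
    (hP : (Ideal.span (Set.range P)).radical = (latticeIdeal K (relationLattice g)).radical)
    {E : Finset (Fin t)} (hE : IsMinimalNonFace A r E) :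
    ∃ j, ∃ w ∈ (P j).support, IsInteriorMonomial A r E w := by
  by_contra! hn
  obtain ⟨F, hF, hF0⟩ := exists_eval_indicatorPoint_ne_zero (K := K) hA hr hE
  refine hF0 (eval_eq_zero_of_mem_radical (J := Ideal.span (Set.range P)) ?_
    (hP ▸ Ideal.le_radical hF))
  refine eval_eq_zero_of_mem_span ?_
  rintro _ ⟨j, rfl⟩
  refine eval_indicatorPoint_boundary hr hE (P j) (fun S hS => ?_) (hn j)
  refine eval_eq_zero_of_mem_radical
    (eval_indicatorPoint_latticeIdeal hA (hE.isFace_of_ssubset hr hS)) ?_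
  rw [← hP]
  exact Ideal.le_radical (Ideal.subset_span ⟨j, rfl⟩)

end Radical

/-! ### Comparison of gradings -/

section Specialization

variable {K : Type*} [Field K] {n : ℕ} {M N : Type*} [AddCommGroup M] [AddCommGroup N]

theorem weight_eq_degMap (f : Fin n → M) (w : Fin n →₀ ℕ) :
    Finsupp.weight f w = degMap f fun i => (w i : ℤ) := by
  simp [Finsupp.weight_apply, Finsupp.sum_fintype, degMap, Fintype.linearCombination_apply]

theorem weight_posPart_sub (f : Fin n → M) (α : Fin n → ℤ) :
    Finsupp.weight f (posPart α) - Finsupp.weight f (posPart (-α)) = degMap f α := by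
  rw [weight_eq_degMap, weight_eq_degMap, ← map_sub]
  congr 1
  ext i
  exact posPart_sub_posPart_neg α i

theorem IsHomogeneousIdeal.component_mem {f : Fin n → M} {J : Ideal (MvPolynomial (Fin n) K)}
    (hJ : IsHomogeneousIdeal f J) {F : MvPolynomial (Fin n) K} (hF : F ∈ J) (d : M) :
    weightedHomogeneousComponent f d F ∈ J := by
  classical
  let _ := weightedGradedAlgebra K f
  obtain ⟨S, hS, rfl⟩ := hJ
  refine weightedHomogeneousComponent_mem_of_mem K f ?_ hF d
  exact Ideal.homogeneous_span _ S fun F hF => hS F hF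

/-- The binomial of a relation `α` of `g` generates a `g`-homogeneous, hence `f`-homogeneous, ideal.
If its two monomials had different `f`-degrees, each would lie in that ideal; but the binomial
vanishes at `(1, …, 1)` and a monomial does not. -/
theorem IsSpecialization.relationLattice_le {f : Fin n → M} {g : Fin n → N}
    (h : IsSpecialization K f g) : relationLattice g ≤ relationLattice f := by
  classical
  intro α hα
  have hg : Finsupp.weight g (posPart α) = Finsupp.weight g (posPart (-α)) := by
    rw [← sub_eq_zero, weight_posPart_sub]
    exact hα
  set F : MvPolynomial (Fin n) K := monomial (posPart α) 1 - monomial (posPart (-α)) 1 with hFdef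
  have hhom : IsHomogeneousIdeal f (Ideal.span {F}) := by
    refine h _ ⟨{F}, ?_, rfl⟩
    rintro _ rfl
    refine ⟨Finsupp.weight g (posPart α), ?_⟩
    exact (weightedHomogeneousSubmodule K g _).sub_mem
      (isWeightedHomogeneous_monomial g _ _ rfl) (isWeightedHomogeneous_monomial g _ _ hg.symm)
  by_contra hne
  have hf : Finsupp.weight f (posPart (-α)) ≠ Finsupp.weight f (posPart α) := by
    intro heq
    refine hne ?_
    change degMap f α = 0
    rw [← weight_posPart_sub, heq, sub_self]
  have hmem := hhom.component_mem (Ideal.mem_span_singleton_self F) (Finsupp.weight f (posPart α))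
  have hcomp : weightedHomogeneousComponent f (Finsupp.weight f (posPart α)) F =
      monomial (posPart α) 1 := by
    rw [hFdef, map_sub,
      weightedHomogeneousComponent_of_mem (isWeightedHomogeneous_monomial f _ _ rfl),
      weightedHomogeneousComponent_of_mem (isWeightedHomogeneous_monomial f _ _ rfl),
      if_pos rfl, if_neg hf.symm, sub_zero]
  rw [hcomp] at hmem
  have h0 := eval_eq_zero_of_mem_span (p := fun _ => (1 : K)) (S := {F})
    (by rintro _ rfl; simp [F, eval_monomial]) _ hmem
  simp [eval_monomial] at h0

theorem saturation_mono {L L' : Submodule ℤ (Fin n → ℤ)} (h : L ≤ L') :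
    saturation L ⊆ saturation L' :=
  fun _ ⟨d, hd, hdα⟩ => ⟨d, hd, h hdα⟩

theorem finite_components (f : Fin n → M) (F : MvPolynomial (Fin n) K) :
    {d : M | weightedHomogeneousComponent f d F ≠ 0}.Finite :=
  weightedHomogeneousComponent_finsupp F

theorem component_weight_ne_zero (f : Fin n → M) {F : MvPolynomial (Fin n) K} {w : Fin n →₀ ℕ}
    (hw : w ∈ F.support) : weightedHomogeneousComponent f (Finsupp.weight f w) F ≠ 0 := by
  classical
  intro h0
  have h := congrArg (coeff w) h0
  rw [coeff_weightedHomogeneousComponent, if_pos rfl, coeff_zero] at h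
  exact mem_support_iff.mp hw h

end Specialization

/-! ### Matchings -/

/-- A family of disjoint simplices that covers all vertices bounds `δ(D)_Ω`. -/
theorem delta_le_card {V β : Type*} [Fintype V] [DecidableEq V]
    (D : PreAbstractSimplicialComplex V) (U : Finset β) (T : β → Finset V)
    (hT : ∀ b ∈ U, (T b).Nonempty → T b ∈ D.faces)
    (hdisj : ∀ b b', b ≠ b' → Disjoint (T b) (T b'))
    (hcov : ∀ v ∈ vertices D, ∃ b ∈ U, v ∈ T b) : delta D ≤ U.card := by
  classical
  let M : Finset (Finset V) := (U.image T).filter Finset.Nonempty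
  -- Maximality is automatic, since the support of any matching consists of vertices and `M` covers
  -- them all.
  have hM : IsMaximalMatching D M := by
    refine ⟨⟨?_, ?_⟩, ?_⟩
    · intro S hS
      obtain ⟨hS, hne⟩ := Finset.mem_filter.mp hS
      obtain ⟨b, hb, rfl⟩ := Finset.mem_image.mp hS
      exact hT b hb hne
    · intro S hS S' hS' hne
      obtain ⟨b, -, rfl⟩ := Finset.mem_image.mp (Finset.mem_filter.mp hS).1
      obtain ⟨b', -, rfl⟩ := Finset.mem_image.mp (Finset.mem_filter.mp hS').1
      exact hdisj b b' (by rintro rfl; exact hne rfl)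
    · intro M' hM'
      refine Finset.card_le_card fun v hv => ?_
      obtain ⟨S, hS, hvS⟩ := Finset.mem_biUnion.mp hv
      have hv' : v ∈ vertices D :=
        (D.isRelLowerSet_faces (hM'.1 S hS)).2 (Finset.singleton_subset_iff.mpr hvS)
          (Finset.singleton_nonempty v)
      obtain ⟨b, hb, hvb⟩ := hcov v hv'
      exact Finset.mem_biUnion.mpr ⟨T b, Finset.mem_filter.mpr
        ⟨Finset.mem_image_of_mem T hb, v, hvb⟩, hvb⟩
  calc delta D ≤ M.card := Nat.sInf_le ⟨M, hM, rfl⟩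
    _ ≤ (U.image T).card := Finset.card_filter_le _ _
    _ ≤ U.card := Finset.card_image_le

/-- The projection of the degree of an interior monomial is interior to the projected cone. -/
theorem IsInteriorMonomial.sum_mem_relintCone {n m q t : ℕ} {A : Fin n → Fin m → ℤ}
    {B : Fin n → Fin q → ℤ} {r : Fin t → Fin m → ℤ} (hAB : relationLattice A ≤ relationLattice B)
    {E : Finset (Fin t)} {w : Fin n →₀ ℕ} (hw : IsInteriorMonomial A r E w) :
    toRat (degMap B fun i => (w i : ℤ)) ∈
      relintCone E fun j => coneProjection A B (toRat (r j)) := by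
  obtain ⟨d, hd, hsum⟩ := hw.2
  refine ⟨d, hd, ?_⟩
  have h := congrArg (coneProjection A B) hsum
  simp only [map_sum, map_smul, coneProjection_apply A B hAB] at h
  rw [← h, ← toRat_sum]
  rfl

end LatticeIdeal

/-! ### The two lower bounds -/

open LatticeIdeal in
theorem theorem3p11 {K : Type*} [Field K] {n : ℕ}
    {𝒢 ℱ : Type*} [AddCommGroup 𝒢] [AddCommGroup ℱ]
    -- the groups with their distinguished generators; the first grading is positive
    (g : Fin n → 𝒢) (hg : AddSubgroup.closure (Set.range g) = ⊤)
    (f : Fin n → ℱ) (hf : AddSubgroup.closure (Set.range f) = ⊤)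
    (hpos : IsPositiveGrading g) (hspec : IsSpecialization K f g)
    -- any vector configurations that define the cones of the two groups
    {m q : ℕ} (A : Fin n → Fin m → ℤ)
    (hA : saturation (relationLattice g) = (relationLattice A : Set (Fin n → ℤ)))
    (B : Fin n → Fin q → ℤ)
    (hB : saturation (relationLattice f) = (relationLattice B : Set (Fin n → ℤ)))
    -- any choice of extreme vectors of the first cone
    {t : ℕ} (r : Fin t → Fin m → ℤ) (hr : IsExtremeVectors A r)
    {s : ℕ} (P : Fin s → MvPolynomial (Fin n) K)
    (hP : (Ideal.span (Set.range P)).radical = (latticeIdeal K (relationLattice g)).radical) :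
    (vertices (complexD A A r)).ncard ≤ (Finset.univ.biUnion fun i => (P i).support).card ∧
      delta (complexD A B r) ≤ ∑ i, numComponents f (P i) := by
  classical
  choose j w hw hint using fun E (hE : IsMinimalNonFace A r E) =>
    exists_interiorMonomial hA hr hP hE
  constructor
  · rw [vertices_complexD, Set.ncard_eq_toFinset_card _ (Set.toFinite _)]
    refine Finset.card_le_card_of_injOn
      -- The default value is never used: only vertices are mapped.
      (fun E => if hE : IsMinimalNonFace A r E then w E hE else 0) ?_ ?_
    · intro E hE
      have hE' : IsMinimalNonFace A r E := by simpa using hE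
      simp only [dif_pos hE']
      exact Finset.mem_biUnion.mpr ⟨j E hE', Finset.mem_univ _, hw E hE'⟩
    · intro E hE E' hE' heq
      have h1 : IsMinimalNonFace A r E := by simpa using hE
      have h2 : IsMinimalNonFace A r E' := by simpa using hE'
      simp only [dif_pos h1, dif_pos h2] at heq
      have hi := hint E h1
      rw [heq] at hi
      exact Finset.Subset.antisymm ((hint E' h2).subset hi h2 h1 hr)
        (hi.subset (hint E' h2) h1 h2 hr)
  · have hAB : relationLattice A ≤ relationLattice B := by
      intro α hα
      have h1 : α ∈ saturation (relationLattice g) := by rw [hA]; exact hα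
      have h2 := saturation_mono hspec.relationLattice_le h1
      rwa [hB] at h2
    have hfB := relationLattice_le_of_saturation hB
    let U : Finset (Σ _ : Fin s, ℱ) :=
      Finset.univ.sigma fun i => (finite_components f (P i)).toFinset
    have hU : U.card = ∑ i, numComponents f (P i) := by
      rw [Finset.card_sigma]
      exact Finset.sum_congr rfl fun i _ =>
        (Set.ncard_eq_toFinset_card _ (finite_components f (P i))).symm
    rw [← hU]
    -- `U` indexes the nonzero components of all `P i`; the vertex `E` is assigned to the component
    -- containing its chosen monomial.
    refine delta_le_card _ U (fun b => Finset.univ.filter fun E =>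
      ∃ hE : IsMinimalNonFace A r E, (⟨j E hE, Finsupp.weight f (w E hE)⟩ : Σ _ : Fin s, ℱ) = b)
      ?_ ?_ ?_
    · rintro ⟨i, d⟩ - hne
      obtain ⟨E₀, hE₀⟩ := id hne
      obtain ⟨h₀, hb₀⟩ := (Finset.mem_filter.mp hE₀).2
      refine ⟨hne, fun E hE => (Finset.mem_filter.mp hE).2.1,
        toRat (degMap B fun i => (w E₀ h₀ i : ℤ)), ?_⟩
      simp only [Set.mem_iInter]
      intro E hE
      obtain ⟨h, hb⟩ := (Finset.mem_filter.mp hE).2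
      have hd : Finsupp.weight f (w E h) = Finsupp.weight f (w E₀ h₀) := by
        have := hb.trans hb₀.symm
        simp only [Sigma.mk.injEq, heq_eq_eq] at this
        exact this.2
      -- Equal `f`-degrees give equal `B`-degrees, so the degree of one chosen monomial serves as
      -- the common point for the whole group.
      have hB' : degMap B (fun i => (w E h i : ℤ)) = degMap B fun i => (w E₀ h₀ i : ℤ) := by
        rw [weight_eq_degMap, weight_eq_degMap, ← sub_eq_zero, ← map_sub] at hd
        rw [← sub_eq_zero, ← map_sub]
        exact hfB hd
      rw [← hB']
      exact (hint E h).sum_mem_relintCone hAB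
    · intro b b' hbb'
      rw [Finset.disjoint_left]
      intro E hE hE'
      obtain ⟨h, hb⟩ := (Finset.mem_filter.mp hE).2
      obtain ⟨_, hb'⟩ := (Finset.mem_filter.mp hE').2
      exact hbb' (hb.symm.trans hb')
    · intro E hE
      rw [vertices_complexD] at hE
      refine ⟨⟨j E hE, Finsupp.weight f (w E hE)⟩, ?_, ?_⟩
      · simp only [U, Finset.mem_sigma, Finset.mem_univ, true_and, Set.Finite.mem_toFinset]
        exact component_weight_ne_zero f (hw E hE)
      · exact Finset.mem_filter.mpr ⟨Finset.mem_univ _, hE, rfl⟩
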